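/- **Theorem 4.5.** An $\Omega$-group is a group (written additively, not necessarily commutative) with a family $\Omega$ of finitary operations such that $\omega(0,\dots,0)=0$ for all $\omega\in\Omega$; an ideal of an $\Omega$-group is the kernel of a homomorphism. Let $\mathcal C$ be a variety of $\Omega$-groups, regarded as a category with all homomorphisms as morphisms, and let $\mathcal X$ be the subvariety of $\mathcal C$ determined by a set $\Phi$ of identities, regarded as a full subcategory. Then the inclusion $\mathcal X\to\mathcal C$ has a left adjoint (the reflection) $F:\mathcal C\to\mathcal X$, and the following conditions are equivalent: 1. $\mathcal X$ is a semisimple class in $\mathcal C$ in the sense of Kurosh–Amitsur: there is a class $\mathcal R$ of objects of $\mathcal C$, closed under homomorphic images, such that every $A\in\mathcal C$ has a largest ideal $\mathcal R(A)$ belonging to $\mathcal R$, such that $\mathcal R(A/\mathcal R(A))=0$ for all $A \in \mathcal C$, and such that $\mathcal X=\{A\in\mathcal C : \mathcal R(A)=0\}$. 2. $\mathcal X$ is an attainable subvariety of $\mathcal C$: for every $A\in\mathcal C$ one has $A(\Phi)(\Phi)=A(\Phi)$, where, for every $B\in\mathcal C$, $B(\Phi)$ denotes the intersection of all ideals $I$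 of $B$ such that $B/I$ satisfies all identities in $\Phi$. 3. Every object $A$ of $\mathcal C$ is $F$-admissible: the functor $(\mathcal C\downarrow A)\to(\mathcal X\downarrow F(A))$ induced by $F$ has a fully faithful right adjoint. 4. $F$ is semi-left-exact: it preserves all pullbacks in $\mathcal C$ of a morphism of $\mathcal X$ along an arbitrary morphism $A\to Y$ with $A\in\mathcal C$ and $Y\in\mathcal X$. 5. $F$ is essentially a fibration: for every $A\in\mathcal C$ and every morphism $h:Y\to F(A)$ in $\mathcal X$ there are an $F$-cartesian morphism $\varphi:B\to A$ in $\mathcal C$ and an isomorphism $e:F(B)\to Y$ with $h\circ e=F(\varphi)$. Here $\varphi : B\to A$ is $F$-cartesian if for every $\psi:B'\to A$ in $\mathcal C$ and every $k:F(B')\to F(B)$ with $F(\varphi)\circ k=F(\psi)$ there is a unique $\chi:B'\to B$ with $\varphi\circ\chi=\psi$ and $F(\chi)=k$. -/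

import Mathlib

open CategoryTheory CategoryTheory.Limits

universe w u

/-- A signature of multiple operators: a set of operator symbols, each with a finite arity. -/
structure OmegaSignature where
  /-- the operator symbols -/
  Op : Type w
  /-- the arities -/
  arity : Op → ℕ

/-- An `Ω`-group (group with multiple operators, in the sense of Higgins): a group, written
additively but not assumed commutative, with finitary operations `op ω` such that
`op ω (0, …, 0) = 0`. -/
class OmegaGroup (S : OmegaSignature.{w}) (A : Type u) [AddGroup A] where
  /-- the additional operations -/
  op (ω : S.Op) : (Fin (S.arity ω) → A) → A
  op_zero (ω : S.Op) : op ω (fun _ => 0) = 0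

/-- Terms in the language of `Ω`-groups, in countably many variables. -/
inductive OmegaTerm (S : OmegaSignature.{w}) : Type w
  | var : ℕ → OmegaTerm S
  | zero : OmegaTerm S
  | add : OmegaTerm S → OmegaTerm S → OmegaTerm S
  | neg : OmegaTerm S → OmegaTerm S
  | op (ω : S.Op) : (Fin (S.arity ω) → OmegaTerm S) → OmegaTerm S

/-- The value of a term under an assignment of the variables. -/
def OmegaTerm.eval {S : OmegaSignature.{w}} {A : Type u} [AddGroup A] [OmegaGroup S A]
    (v : ℕ → A) : OmegaTerm S → A
  | .var n => v n
  | .zero => 0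
  | .add s t => s.eval v + t.eval v
  | .neg t => -t.eval v
  | .op ω t => OmegaGroup.op ω (fun i => (t i).eval v)

/-- An identity is a formal equation between two terms. -/
abbrev OmegaIdentity (S : OmegaSignature.{w}) : Type w := OmegaTerm S × OmegaTerm S

/-- `A` satisfies all identities of `Φ`. -/
def SatisfiesIdentities {S : OmegaSignature.{w}} (Φ : Set (OmegaIdentity S)) (A : Type u)
    [AddGroup A] [OmegaGroup S A] : Prop :=
  ∀ e ∈ Φ, ∀ v : ℕ → A, e.1.eval v = e.2.eval v

/-- Homomorphisms of `Ω`-groups. -/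
structure OmegaHom (S : OmegaSignature.{w}) (A B : Type u) [AddGroup A] [OmegaGroup S A]
    [AddGroup B] [OmegaGroup S B] extends A →+ B where
  map_op' (ω : S.Op) (a : Fin (S.arity ω) → A) :
    toFun (OmegaGroup.op ω a) = OmegaGroup.op ω (fun i => toFun (a i))

section Satisfaction

variable {S : OmegaSignature.{w}} {A B : Type u} [AddGroup A] [OmegaGroup S A]
  [AddGroup B] [OmegaGroup S B]

theorem OmegaHom.map_eval (f : OmegaHom S A B) (v : ℕ → A) (t : OmegaTerm S) :
    f.toAddMonoidHom (t.eval v) = t.eval (fun n => f.toAddMonoidHom (v n)) := by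
  induction t with
  | var n => rfl
  | zero => exact map_zero _
  | add s t hs ht => simp only [OmegaTerm.eval, map_add, hs, ht]
  | neg t ht => simp only [OmegaTerm.eval, map_neg, ht]
  | op ω t ht =>
    simp only [OmegaTerm.eval]
    rw [← funext ht]
    exact f.map_op' ω _

theorem SatisfiesIdentities.of_injective {Φ : Set (OmegaIdentity S)} (f : OmegaHom S A B)
    (hf : Function.Injective f.toAddMonoidHom) (h : SatisfiesIdentities Φ B) :
    SatisfiesIdentities Φ A := by
  intro e he v
  apply hf
  rw [f.map_eval, f.map_eval]
  exact h e he _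

theorem SatisfiesIdentities.of_surjective {Φ : Set (OmegaIdentity S)} (f : OmegaHom S A B)
    (hf : Function.Surjective f.toAddMonoidHom) (h : SatisfiesIdentities Φ A) :
    SatisfiesIdentities Φ B := by
  intro e he v
  choose a ha using fun n => hf (v n)
  have h2 := congrArg f.toAddMonoidHom (h e he a)
  rw [f.map_eval, f.map_eval, funext ha] at h2
  exact h2

end Satisfaction

/-- An ideal of an `Ω`-group: a normal subgroup `I` such that
`op ω (a + x) - op ω a ∈ I` whenever all the `x i` are in `I`. -/
structure OmegaIdeal (S : OmegaSignature.{w}) (A : Type u) [AddGroup A] [OmegaGroup S A]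
    extends AddSubgroup A where
  normal' : toAddSubgroup.Normal
  op_sub_mem' (ω : S.Op) (a x : Fin (S.arity ω) → A) (hx : ∀ i, x i ∈ toAddSubgroup) :
    OmegaGroup.op ω (fun i => a i + x i) - OmegaGroup.op ω a ∈ toAddSubgroup

namespace OmegaIdeal

variable {S : OmegaSignature.{w}} {A : Type u} [AddGroup A] [OmegaGroup S A]

instance (I : OmegaIdeal S A) : I.toAddSubgroup.Normal := I.normal'

theorem op_mem (I : OmegaIdeal S A) (ω : S.Op) (x : Fin (S.arity ω) → A)
    (hx : ∀ i, x i ∈ I.toAddSubgroup) : OmegaGroup.op ω x ∈ I.toAddSubgroup := by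
  have h := I.op_sub_mem' ω (fun _ => 0) x hx
  simpa [OmegaGroup.op_zero] using h

/-- An ideal, regarded as an `Ω`-group with the restricted operations. -/
instance (I : OmegaIdeal S A) : OmegaGroup S I.toAddSubgroup where
  op ω x := ⟨OmegaGroup.op ω (fun i => (x i : A)), I.op_mem ω _ (fun i => (x i).2)⟩
  op_zero ω := Subtype.ext (OmegaGroup.op_zero (A := A) ω)

/-- The inclusion of an ideal. -/
def incl (I : OmegaIdeal S A) : OmegaHom S I.toAddSubgroup A where
  toAddMonoidHom := I.toAddSubgroup.subtype
  map_op' _ _ := rfl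

theorem op_congr (I : OmegaIdeal S A) (ω : S.Op) (a b : Fin (S.arity ω) → A)
    (h : ∀ i, (a i : A ⧸ I.toAddSubgroup) = (b i : A ⧸ I.toAddSubgroup)) :
    ((OmegaGroup.op ω a : A) : A ⧸ I.toAddSubgroup) = (OmegaGroup.op ω b : A) := by
  have h2 := I.op_sub_mem' ω a (fun i => -a i + b i) (fun i => QuotientAddGroup.eq.1 (h i))
  simp only [add_neg_cancel_left] at h2
  rw [eq_comm, ← sub_eq_zero, ← QuotientAddGroup.mk_sub, QuotientAddGroup.eq_zero_iff]
  exact h2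

/-- The quotient by an ideal, as an `Ω`-group. The operations are computed on representatives;
see `mk_op` for the independence of the choice. -/
noncomputable instance (I : OmegaIdeal S A) : OmegaGroup S (A ⧸ I.toAddSubgroup) where
  op ω x := ((OmegaGroup.op ω (fun i => (x i).out) : A) : A ⧸ I.toAddSubgroup)
  op_zero ω := by
    rw [I.op_congr ω _ (fun _ => 0) (fun i => by simp), OmegaGroup.op_zero]
    rfl

theorem mk_op (I : OmegaIdeal S A) (ω : S.Op) (a : Fin (S.arity ω) → A) :
    ((OmegaGroup.op ω a : A) : A ⧸ I.toAddSubgroup) =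
      OmegaGroup.op ω (fun i => (a i : A ⧸ I.toAddSubgroup)) :=
  I.op_congr ω _ _ (fun i => by simp)

/-- The canonical projection onto the quotient. -/
def proj (I : OmegaIdeal S A) : OmegaHom S A (A ⧸ I.toAddSubgroup) where
  toAddMonoidHom := QuotientAddGroup.mk' I.toAddSubgroup
  map_op' ω a := I.mk_op ω a

/-- The ideal `A(Φ)`: the intersection of all ideals `I` of `A` such that `A / I` satisfies `Φ`. -/
def verbal (Φ : Set (OmegaIdentity S)) (A : Type u) [AddGroup A] [OmegaGroup S A] :
    OmegaIdeal S A where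
  toAddSubgroup := ⨅ I : {I : OmegaIdeal S A // SatisfiesIdentities Φ (A ⧸ I.toAddSubgroup)},
    I.1.toAddSubgroup
  normal' := AddSubgroup.normal_iInf_normal fun I => I.1.normal'
  op_sub_mem' ω a x hx := by
    simp only [AddSubgroup.mem_iInf] at hx ⊢
    exact fun I => I.1.op_sub_mem' ω a x (fun i => hx i I)

end OmegaIdeal

/-- The objects of the variety of `Ω`-groups defined by the set `E` of identities. -/
structure OmegaVariety {S : OmegaSignature.{w}} (E : Set (OmegaIdentity S)) where
  /-- the underlying set -/
  carrier : Type u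
  [addGroup : AddGroup carrier]
  [omegaGroup : OmegaGroup S carrier]
  satisfies : SatisfiesIdentities E carrier

namespace OmegaVariety

variable {S : OmegaSignature.{w}} {E : Set (OmegaIdentity S)}

instance : CoeSort (OmegaVariety.{w, u} E) (Type u) := ⟨OmegaVariety.carrier⟩

attribute [instance] OmegaVariety.addGroup OmegaVariety.omegaGroup

/-- A variety of `Ω`-groups as a category: the morphisms are all homomorphisms. -/
instance : Category.{u} (OmegaVariety.{w, u} E) where
  Hom A B := OmegaHom S A B
  id A := { AddMonoidHom.id A with map_op' := fun _ _ => rfl }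
  comp f g :=
    { g.toAddMonoidHom.comp f.toAddMonoidHom with
      map_op' := fun ω a =>
        (congrArg g.toAddMonoidHom (f.map_op' ω a)).trans (g.map_op' ω _) }

/-- An ideal of an object of a variety, as an object of that variety. -/
def ofIdeal (A : OmegaVariety.{w, u} E) (I : OmegaIdeal S A) : OmegaVariety.{w, u} E where
  carrier := I.toAddSubgroup
  satisfies := A.satisfies.of_injective I.incl Subtype.val_injective

/-- A quotient of an object of a variety, as an object of that variety. -/
noncomputable def quotient (A : OmegaVariety.{w, u} E) (I : OmegaIdeal S A) :
    OmegaVariety.{w, u} E where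
  carrier := A ⧸ I.toAddSubgroup
  satisfies := A.satisfies.of_surjective I.proj (QuotientAddGroup.mk'_surjective _)

/-- The subvariety of the variety `E` determined by a further set `Φ` of identities, as a
(full and replete) class of objects. -/
def subvariety (E Φ : Set (OmegaIdentity S)) : ObjectProperty (OmegaVariety.{w, u} E) :=
  fun A => SatisfiesIdentities Φ A

/-- A Kurosh–Amitsur radical class in a variety of `Ω`-groups: a class `R` closed under homomorphic
images, such that every `A` has a largest ideal `R(A)` belonging to `R` and `A / R(A)` has no
non-zero ideals belonging to `R`, that is, `R(A / R(A)) = 0`. -/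
structure IsRadicalClass (R : ObjectProperty (OmegaVariety.{w, u} E)) : Prop where
  of_surjective (A B : OmegaVariety.{w, u} E) (f : A ⟶ B)
    (hf : Function.Surjective f.toAddMonoidHom) (hA : R A) : R B
  exists_radical (A : OmegaVariety.{w, u} E) : ∃ I : OmegaIdeal S A,
    R (A.ofIdeal I) ∧
    (∀ J : OmegaIdeal S A, R (A.ofIdeal J) → J.toAddSubgroup ≤ I.toAddSubgroup) ∧
    ∀ J : OmegaIdeal S (A.quotient I), R ((A.quotient I).ofIdeal J) → J.toAddSubgroup = ⊥

/-- The class of `R`-semisimple objects: those without non-zero ideals belonging to `R`. For a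
radical class `R` this says `R(A) = 0`. -/
def semisimpleObjects (R : ObjectProperty (OmegaVariety.{w, u} E)) :
    ObjectProperty (OmegaVariety.{w, u} E) :=
  fun A => ∀ J : OmegaIdeal S A, R (A.ofIdeal J) → J.toAddSubgroup = ⊥

/-- `X` is a semisimple class in the sense of Kurosh–Amitsur radical theory: it is the class of
`R`-semisimple objects of some radical class `R`. -/
def IsSemisimpleClass (X : ObjectProperty (OmegaVariety.{w, u} E)) : Prop :=
  ∃ R : ObjectProperty (OmegaVariety.{w, u} E), IsRadicalClass R ∧ X = semisimpleObjects R

/-- `Φ` is attainable on `A`: `A(A(Φ)) = A(Φ)`, i.e. for the `Ω`-group `B = A(Φ)` one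
has `B(Φ) = B`. -/
def IsAttainableOn (Φ : Set (OmegaIdentity S)) (A : OmegaVariety.{w, u} E) : Prop :=
  (OmegaIdeal.verbal Φ (OmegaIdeal.verbal Φ A).toAddSubgroup).toAddSubgroup = ⊤

end OmegaVariety

section Reflections

universe v₁ v₂ u₁ u₂

variable {C : Type u₁} [Category.{v₁} C] {D : Type u₂} [Category.{v₂} D]

/-- `A` is `F`-admissible: the functor `(C ↓ A) ⥤ (D ↓ F A)` induced by `F` has a right adjoint
which is fully faithful. (Right adjoints being unique up to isomorphism, it does not matter which
right adjoint is taken.) -/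
def IsAdmissibleObject (F : C ⥤ D) (A : C) : Prop :=
  ∃ G : Over (F.obj A) ⥤ Over A,
    Nonempty (Over.post (X := A) F ⊣ G) ∧ G.Full ∧ G.Faithful

/-- A reflection `F` onto the full subcategory with inclusion `i` is semi-left-exact if it
preserves pullbacks along the morphisms of the subcategory. -/
def IsSemiLeftExact (F : C ⥤ D) (i : D ⥤ C) : Prop :=
  ∀ ⦃A : C⦄ ⦃X Y : D⦄ (f : A ⟶ i.obj Y) (g : X ⟶ Y), PreservesLimit (cospan f (i.map g)) F

/-- `F` is essentially a fibration (a fibration up to isomorphism): for every `h : Y ⟶ F A` there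
is a cartesian morphism `φ : B ⟶ A` whose image is isomorphic to `h` over `F A`. Here
`φ` is cartesian if every `ψ : B' ⟶ A` together with a factorization `F ψ = k ≫ F φ` lifts uniquely
to a factorization `ψ = χ ≫ φ` with `F χ = k`. -/
def IsEssentiallyFibration (F : C ⥤ D) : Prop :=
  ∀ ⦃A : C⦄ ⦃Y : D⦄ (h : Y ⟶ F.obj A), ∃ (B : C) (φ : B ⟶ A) (e : F.obj B ≅ Y),
    e.hom ≫ h = F.map φ ∧ F.IsStronglyCartesian (F.map φ) φ

end Reflections

/-! Everything is compared with attainability, `A(Φ)(Φ) = A(Φ)`. The basic fact is that `A / A(Φ)`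
is the largest quotient of `A` satisfying `Φ`. Hence it is the reflection of `A`, and `B(Φ) = B`
exactly when every homomorphism from `B` to an object satisfying `Φ` is zero.

For semisimplicity, the radical class is that of all `B` with `B(Φ) = B`, and attainability says
that `A(Φ)` belongs to it. Conversely, any radical class with semisimple class `X` has radical
`A(Φ)`, and a member of the class has no non-zero quotient in `X`.

Attainability gives the three categorical conditions through one property, `IsAdmissibleReflection`:
pulling back the unit of `A` along `h : X ⟶ F A` gives a surjection onto `X` with kernel a copy of
`A(Φ)`. As `A(Φ)` has only zero maps to objects satisfying `Φ`, this kernel lies in the verbal ideal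
of the pullback, so the surjection is again a unit up to isomorphism.

Conversely, each categorical condition is applied to `0 ⟶ F A`. It yields `φ : B ⟶ A` with `F B`
trivial through which the inclusion of `A(Φ)` factors, and `isAttainableOn_of_factorization`
concludes. -/

section OmegaGroups

variable {S : OmegaSignature.{w}} {A B C : Type u} [AddGroup A] [OmegaGroup S A]
  [AddGroup B] [OmegaGroup S B] [AddGroup C] [OmegaGroup S C]

/-! ### Homomorphisms, quotients and verbal ideals -/

namespace OmegaHom

/-- The composition of homomorphisms of `Ω`-groups. -/
def comp (g : OmegaHom S B C) (f : OmegaHom S A B) : OmegaHom S A C where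
  toAddMonoidHom := g.toAddMonoidHom.comp f.toAddMonoidHom
  map_op' ω a := (congrArg g.toAddMonoidHom (f.map_op' ω a)).trans (g.map_op' ω _)

theorem map_op (f : OmegaHom S A B) (ω : S.Op) (a : Fin (S.arity ω) → A) :
    f.toAddMonoidHom (OmegaGroup.op ω a) = OmegaGroup.op ω (fun i => f.toAddMonoidHom (a i)) :=
  f.map_op' ω a

/-- The kernel of a homomorphism, as an ideal. -/
def ker (f : OmegaHom S A B) : OmegaIdeal S A where
  toAddSubgroup := f.toAddMonoidHom.ker
  normal' := inferInstance
  op_sub_mem' ω a x hx := by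
    simp only [AddMonoidHom.mem_ker] at hx ⊢
    simp [map_op, hx]

theorem mem_ker {f : OmegaHom S A B} {a : A} :
    a ∈ f.ker.toAddSubgroup ↔ f.toAddMonoidHom a = 0 := AddMonoidHom.mem_ker

/-- The homomorphism out of a quotient induced by a homomorphism vanishing on the ideal. -/
def quotientLift (I : OmegaIdeal S A) (f : OmegaHom S A B)
    (h : I.toAddSubgroup ≤ f.ker.toAddSubgroup) : OmegaHom S (A ⧸ I.toAddSubgroup) B where
  toAddMonoidHom := QuotientAddGroup.lift I.toAddSubgroup f.toAddMonoidHom h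
  map_op' ω x := by
    choose a ha using fun i => QuotientAddGroup.mk_surjective (x i)
    obtain rfl : (fun i => (a i : A ⧸ I.toAddSubgroup)) = x := funext ha
    change QuotientAddGroup.lift I.toAddSubgroup f.toAddMonoidHom h _ = _
    rw [← I.mk_op]
    exact f.map_op ω a

/-- The image of an ideal under a surjective homomorphism is an ideal. -/
def mapIdeal (f : OmegaHom S A B) (hf : Function.Surjective f.toAddMonoidHom)
    (I : OmegaIdeal S A) : OmegaIdeal S B where
  toAddSubgroup := I.toAddSubgroup.map f.toAddMonoidHom
  normal' := I.normal'.map _ hf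
  op_sub_mem' ω b y hy := by
    choose a ha using fun i => hf (b i)
    choose x hx hxy using fun i => AddSubgroup.mem_map.1 (hy i)
    refine AddSubgroup.mem_map.2 ⟨_, I.op_sub_mem' ω a x hx, ?_⟩
    simp [map_op, ha, hxy]

/-- The restriction of the codomain of a homomorphism to an ideal containing its values. -/
def codRestrict (f : OmegaHom S A B) (I : OmegaIdeal S B)
    (h : ∀ a, f.toAddMonoidHom a ∈ I.toAddSubgroup) : OmegaHom S A I.toAddSubgroup where
  toAddMonoidHom := f.toAddMonoidHom.codRestrict I.toAddSubgroup h
  map_op' ω _ := Subtype.ext (f.map_op ω _)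

end OmegaHom

namespace OmegaIdeal

instance : Top (OmegaIdeal S A) where
  top := { toAddSubgroup := ⊤, normal' := inferInstance, op_sub_mem' := fun _ _ _ _ => trivial }

theorem proj_surjective (I : OmegaIdeal S A) : Function.Surjective I.proj.toAddMonoidHom :=
  QuotientAddGroup.mk'_surjective _

theorem proj_eq_zero_iff (I : OmegaIdeal S A) {a : A} :
    I.proj.toAddMonoidHom a = 0 ↔ a ∈ I.toAddSubgroup :=
  QuotientAddGroup.eq_zero_iff a

variable {Φ : Set (OmegaIdentity S)}

theorem verbal_le (I : OmegaIdeal S A) (h : SatisfiesIdentities Φ (A ⧸ I.toAddSubgroup)) :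
    (verbal Φ A).toAddSubgroup ≤ I.toAddSubgroup :=
  iInf_le (fun I : {I : OmegaIdeal S A // SatisfiesIdentities Φ (A ⧸ I.toAddSubgroup)} =>
    I.1.toAddSubgroup) ⟨I, h⟩

/-- For each identity, the two sides evaluated at representatives differ by an element of every
ideal in the intersection. -/
theorem satisfies_quotient_verbal (Φ : Set (OmegaIdentity S)) (A : Type u) [AddGroup A]
    [OmegaGroup S A] : SatisfiesIdentities Φ (A ⧸ (verbal Φ A).toAddSubgroup) := by
  intro e he v
  choose a ha using fun n => (verbal Φ A).proj_surjective (v n)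
  obtain rfl : (fun n => (verbal Φ A).proj.toAddMonoidHom (a n)) = v := funext ha
  rw [← OmegaHom.map_eval, ← OmegaHom.map_eval, ← sub_eq_zero, ← map_sub, proj_eq_zero_iff]
  refine AddSubgroup.mem_iInf.2 fun I => ?_
  rw [← proj_eq_zero_iff, map_sub, sub_eq_zero, OmegaHom.map_eval, OmegaHom.map_eval]
  exact I.2 e he _

theorem verbal_le_ker (f : OmegaHom S A B) (hB : SatisfiesIdentities Φ B) :
    (verbal Φ A).toAddSubgroup ≤ f.ker.toAddSubgroup :=
  verbal_le _ (hB.of_injective (OmegaHom.quotientLift f.ker f le_rfl)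
    (QuotientAddGroup.kerLift_injective f.toAddMonoidHom))

theorem map_eq_zero_of_mem_verbal (f : OmegaHom S A B) (hB : SatisfiesIdentities Φ B) {a : A}
    (ha : a ∈ (verbal Φ A).toAddSubgroup) : f.toAddMonoidHom a = 0 :=
  OmegaHom.mem_ker.1 (verbal_le_ker f hB ha)

theorem satisfies_of_verbal_eq_bot (h : (verbal Φ A).toAddSubgroup = ⊥) :
    SatisfiesIdentities Φ A := by
  refine (satisfies_quotient_verbal Φ A).of_injective (verbal Φ A).proj ?_
  rw [injective_iff_map_eq_zero]
  intro a ha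
  rwa [proj_eq_zero_iff, h, AddSubgroup.mem_bot] at ha

/-- An `Ω`-group all of whose homomorphisms into `Ω`-groups satisfying `Φ` vanish coincides with
its verbal ideal. -/
theorem verbal_eq_top_of_forall_map_eq_zero
    (h : ∀ a, (verbal Φ A).proj.toAddMonoidHom a = 0) : (verbal Φ A).toAddSubgroup = ⊤ :=
  (AddSubgroup.eq_top_iff' _).2 fun a => (proj_eq_zero_iff _).1 (h a)

end OmegaIdeal

end OmegaGroups

/-! ### Semisimple classes and attainability -/

namespace OmegaVariety

open OmegaIdeal

variable {S : OmegaSignature.{w}} {E Φ : Set (OmegaIdentity S)}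

theorem hom_ext {A B : OmegaVariety.{w, u} E} {f g : A ⟶ B}
    (h : ∀ a, f.toAddMonoidHom a = g.toAddMonoidHom a) : f = g := by
  have h' : f.toAddMonoidHom = g.toAddMonoidHom := AddMonoidHom.ext h
  rcases f with ⟨f, hf⟩
  rcases g with ⟨g, hg⟩
  cases h'
  rfl

theorem comp_apply {A B C : OmegaVariety.{w, u} E} (f : A ⟶ B) (g : B ⟶ C) (a : A) :
    (f ≫ g).toAddMonoidHom a = g.toAddMonoidHom (f.toAddMonoidHom a) := rfl

theorem congr_hom {A B : OmegaVariety.{w, u} E} {f g : A ⟶ B} (h : f = g) (a : A) :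
    f.toAddMonoidHom a = g.toAddMonoidHom a := by rw [h]

theorem isAttainableOn_of_isSemisimpleClass
    (h : IsSemisimpleClass (subvariety.{w, u} E Φ)) (A : OmegaVariety.{w, u} E) :
    IsAttainableOn Φ A := by
  obtain ⟨R, hR, hX⟩ := h
  have key (Z : OmegaVariety.{w, u} E) (hZ : SatisfiesIdentities Φ Z) :
      ∀ J : OmegaIdeal S Z, R (Z.ofIdeal J) → J.toAddSubgroup = ⊥ :=
    (congrFun hX Z).mp hZ
  -- The image of `f` is a quotient of `B`, so it lies in `R`, and the semisimple object `Z` has no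
  -- non-zero ideal in `R`. Images need not be ideals in general, so the image is supplied as an
  -- ideal `J`.
  have eq_zero {B Z : OmegaVariety.{w, u} E} (hB : R B) (hZ : SatisfiesIdentities Φ Z)
      (f : B ⟶ Z) (J : OmegaIdeal S Z) (hf : ∀ z, z ∈ J.toAddSubgroup ↔
        ∃ b, f.toAddMonoidHom b = z) (b : B) : f.toAddMonoidHom b = 0 := by
    have hJ := key Z hZ J (hR.of_surjective B (Z.ofIdeal J)
      (OmegaHom.codRestrict f J fun b => (hf _).2 ⟨b, rfl⟩) (fun z => by
        obtain ⟨b, hb⟩ := (hf _).1 z.2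
        exact ⟨b, Subtype.ext hb⟩) hB)
    exact (AddSubgroup.eq_bot_iff_forall _).1 hJ _ ((hf _).2 ⟨b, rfl⟩)
  obtain ⟨I, hI, -, hAI⟩ := hR.exists_radical A
  -- The image of `I` in `A / A(Φ)` vanishes, so `I ≤ A(Φ)`; and `A / I` is semisimple, hence
  -- satisfies `Φ`, so `A(Φ) ≤ I`.
  have hVI : verbal Φ A = I := by
    have hle : I.toAddSubgroup ≤ (verbal Φ A).toAddSubgroup := fun a ha => by
      rw [← proj_eq_zero_iff]
      exact eq_zero (Z := A.quotient (verbal Φ A)) hI (satisfies_quotient_verbal Φ A)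
        ((verbal Φ A).proj.comp I.incl) (OmegaHom.mapIdeal _ (proj_surjective _) I)
        (fun z => ⟨fun ⟨a, ha, h⟩ => ⟨⟨a, ha⟩, h⟩, fun ⟨a, h⟩ => ⟨a.1, a.2, h⟩⟩) ⟨a, ha⟩
    have hge := verbal_le (Φ := Φ) I ((congrFun hX (A.quotient I)).mpr hAI)
    have h := le_antisymm hge hle
    generalize verbal Φ A = V at h
    cases V
    cases I
    cases h
    rfl
  subst hVI
  refine verbal_eq_top_of_forall_map_eq_zero fun a => ?_
  exact eq_zero (Z := (A.ofIdeal (verbal Φ A)).quotient (verbal Φ _)) hI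
    (satisfies_quotient_verbal Φ _) (verbal Φ _).proj
    (OmegaHom.mapIdeal _ (proj_surjective _) ⊤)
    (fun z => ⟨fun ⟨a, _, h⟩ => ⟨a, h⟩, fun ⟨a, h⟩ => ⟨a, trivial, h⟩⟩) a

/-- In the class of all `B` with `B(Φ) = B`, the radical of `A` is `A(Φ)`: it belongs to the class
by attainability, and any ideal in the class dies in `A / A(Φ)`. -/
theorem isSemisimpleClass_of_isAttainableOn
    (h : ∀ A : OmegaVariety.{w, u} E, IsAttainableOn Φ A) :
    IsSemisimpleClass (subvariety.{w, u} E Φ) := by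
  refine ⟨fun B => (verbal Φ B).toAddSubgroup = ⊤, ⟨fun A B f hf hA => ?_, fun A => ?_⟩, ?_⟩
  · refine verbal_eq_top_of_forall_map_eq_zero fun b => ?_
    obtain ⟨a, rfl⟩ := hf b
    exact map_eq_zero_of_mem_verbal ((verbal Φ B).proj.comp f) (satisfies_quotient_verbal Φ B)
      (hA ▸ AddSubgroup.mem_top a)
  · refine ⟨verbal Φ A, h A, fun J hJ a ha => ?_, fun J hJ => ?_⟩
    · rw [← proj_eq_zero_iff]
      exact map_eq_zero_of_mem_verbal ((verbal Φ A).proj.comp J.incl)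
        (satisfies_quotient_verbal Φ A) (a := ⟨a, ha⟩) (hJ ▸ AddSubgroup.mem_top _)
    · refine (AddSubgroup.eq_bot_iff_forall _).2 fun a ha => ?_
      exact map_eq_zero_of_mem_verbal J.incl (satisfies_quotient_verbal Φ A) (a := ⟨a, ha⟩)
        (hJ ▸ AddSubgroup.mem_top _)
  · ext A
    refine ⟨fun hA J hJ => ?_, fun hA => satisfies_of_verbal_eq_bot (hA _ (h A))⟩
    refine (AddSubgroup.eq_bot_iff_forall _).2 fun a ha => ?_
    exact map_eq_zero_of_mem_verbal J.incl hA (a := ⟨a, ha⟩) (hJ ▸ AddSubgroup.mem_top _)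

end OmegaVariety

/-! ### Consequences of admissibility for an arbitrary reflection -/

section ReflectionsPullbacks

universe v₁ v₂ u₁ u₂

variable {C : Type u₁} [Category.{v₁} C] {D : Type u₂} [Category.{v₂} D]
  {F : C ⥤ D} {i : D ⥤ C}

/-- A reflection is admissible if the pullback of a component of its unit along any morphism of the
subcategory is again a component of the unit, up to isomorphism. -/
def IsAdmissibleReflection (adj : F ⊣ i) : Prop :=
  ∀ ⦃A : C⦄ ⦃X : D⦄ (h : X ⟶ F.obj A) ⦃P : C⦄ (p : P ⟶ A) (q : P ⟶ i.obj X),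
    IsPullback p q (adj.unit.app A) (i.map h) → IsIso ((adj.homEquiv P X).symm q)

namespace IsAdmissibleReflection

variable {adj : F ⊣ i}

theorem isAdmissibleObject [HasPullbacks C] (hs : IsAdmissibleReflection adj) (A : C) :
    IsAdmissibleObject F A := by
  let a := Over.postAdjunctionLeft (X := A) adj
  have : IsIso a.counit := by
    have (Y : Over (F.obj A)) : IsIso (a.counit.app Y) := by
      -- The right adjoint pulls `i Y` back along the unit of `A`, so the counit at `Y` is the
      -- transpose of a pullback projection.
      have h := hs Y.hom _ _ (IsPullback.of_hasPullback (i.map Y.hom) (adj.unit.app A)).flip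
      have : IsIso ((Over.forget _).map (a.counit.app Y)) := by
        convert! h using 1
        simp [a, Adjunction.homEquiv_counit]
        rfl
      exact isIso_of_reflects_iso _ (Over.forget _)
    exact NatIso.isIso_of_isIso_app _
  have hff := a.fullyFaithfulROfIsIsoCounit
  exact ⟨_, ⟨a⟩, hff.full, hff.faithful⟩

/-- Since `f` factors through the unit of `A`, its pullback is obtained in two stages: first inside
the subcategory, where `i` preserves it, then along the unit, where admissibility applies. -/
theorem isSemiLeftExact [HasPullbacks C] [i.Full] [i.Faithful] (hs : IsAdmissibleReflection adj) :
    IsSemiLeftExact F i := by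
  intro A X Y f g
  let _ : Reflective i := ⟨F, adj⟩
  have := hasLimitsOfShape_of_reflective (J := WalkingCospan) i
  have : PreservesLimitsOfSize.{0, 0} i := adj.rightAdjoint_preservesLimits
  let f' := (adj.homEquiv A Y).symm f
  have hf : adj.unit.app A ≫ i.map f' = f := by simp [f', ← Adjunction.homEquiv_unit]
  have hW := IsPullback.of_hasPullback f' g
  have hP := IsPullback.of_hasPullback f (i.map g)
  rw [hP.preservesLimit_cospan_iff]
  have hiW := hW.map i
  let q : pullback f (i.map g) ⟶ i.obj (pullback f' g) :=
    hiW.lift (pullback.fst _ _ ≫ adj.unit.app A) (pullback.snd _ _)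
      (by rw [Category.assoc, hf, pullback.condition])
  have hq : IsPullback (pullback.fst f (i.map g)) q (adj.unit.app A)
      (i.map (pullback.fst f' g)) := by
    refine (IsPullback.of_right ?_ (hiW.lift_fst _ _ _) hiW.flip).flip
    rw [hiW.lift_snd, hf]
    exact hP.flip
  have := hs _ _ _ hq
  refine hW.of_iso' (asIso ((adj.homEquiv _ _).symm q)) (Iso.refl _) (asIso (adj.counit.app X))
    (asIso (adj.counit.app Y)) ?_ ?_ ?_ ?_
  · apply (adj.homEquiv _ _).injective
    simp [Adjunction.homEquiv_unit, Adjunction.homEquiv_counit, q]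
  · have hq2 : q ≫ i.map (pullback.snd f' g) = pullback.snd _ _ := hiW.lift_snd _ _ _
    simp [Adjunction.homEquiv_counit, ← hq2]
  · simp [f', Adjunction.homEquiv_counit]
  · simp

theorem isEssentiallyFibration [HasPullbacks C] (hs : IsAdmissibleReflection adj) :
    IsEssentiallyFibration F := by
  intro A Y h
  have hP := IsPullback.of_hasPullback (adj.unit.app A) (i.map h)
  have := hs _ _ _ hP
  let e := (adj.homEquiv _ _).symm (pullback.snd (adj.unit.app A) (i.map h))
  have he : e ≫ h = F.map (pullback.fst _ _) := by
    apply (adj.homEquiv _ _).injective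
    rw [Adjunction.homEquiv_naturality_right]
    simp [e, ← hP.w, Adjunction.homEquiv_unit]
  refine ⟨_, pullback.fst _ _, asIso e, he, ⟨fun {B} g ψ hψ => ?_⟩⟩
  have hψ' : F.map ψ = g ≫ F.map (pullback.fst _ _) := by
    simpa using (IsHomLift.fac F (g ≫ F.map (pullback.fst _ _)) ψ).symm
  -- Lying over `g` is a condition on the second component of `χ` alone, so cartesian lifts are maps
  -- into the pullback.
  have hlift (χ : B ⟶ pullback (adj.unit.app A) (i.map h)) :
      F.IsHomLift g χ ↔ χ ≫ pullback.snd _ _ = adj.homEquiv _ _ (g ≫ e) := by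
    have h1 : F.IsHomLift g χ ↔ F.map χ = g :=
      ⟨fun _ => by simpa using (IsHomLift.fac F g χ).symm, fun h => h ▸ inferInstance⟩
    rw [h1, ← cancel_mono e, ← (adj.homEquiv _ _).injective.eq_iff,
      Adjunction.homEquiv_naturality_left]
    simp [e]
  have hw : ψ ≫ adj.unit.app A = adj.homEquiv _ _ (g ≫ e) ≫ i.map h := by
    rw [← Adjunction.homEquiv_naturality_right, Category.assoc, he, ← hψ',
      Adjunction.homEquiv_unit]
    simp
  refine ⟨hP.lift ψ _ hw, ⟨(hlift _).2 (hP.lift_snd _ _ _), hP.lift_fst _ _ _⟩, ?_⟩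
  rintro χ ⟨hχ, hχ'⟩
  exact hP.hom_ext (hχ'.trans (hP.lift_fst _ _ _).symm)
    (((hlift χ).1 hχ).trans (hP.lift_snd _ _ _).symm)

end IsAdmissibleReflection

end ReflectionsPullbacks

/-! ### Construction of the reflection, and fibre products -/

namespace OmegaVariety

open OmegaIdeal

variable {S : OmegaSignature.{w}} {E Φ : Set (OmegaIdentity S)}

theorem isRightAdjoint_ι (E Φ : Set (OmegaIdentity S)) :
    (subvariety.{w, u} E Φ).ι.IsRightAdjoint := by
  let obj (A : OmegaVariety.{w, u} E) : (subvariety.{w, u} E Φ).FullSubcategory :=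
    ⟨A.quotient (verbal Φ A), satisfies_quotient_verbal Φ A⟩
  let e (A : OmegaVariety.{w, u} E) (Z : (subvariety.{w, u} E Φ).FullSubcategory) :
      (obj A ⟶ Z) ≃ (A ⟶ (subvariety.{w, u} E Φ).ι.obj Z) :=
    { toFun := fun f => OmegaHom.comp f.hom (verbal Φ A).proj
      invFun := fun f => ObjectProperty.homMk
        (OmegaHom.quotientLift (verbal Φ A) f (verbal_le_ker f Z.property))
      left_inv := fun f => by
        ext : 1
        refine hom_ext fun a => ?_
        obtain ⟨a, rfl⟩ := (verbal Φ A).proj_surjective a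
        rfl
      right_inv := fun f => hom_ext fun a => rfl }
  exact ⟨_, ⟨Adjunction.adjunctionOfEquivLeft e fun _ _ _ _ _ => rfl⟩⟩

/-- The trivial object. -/
def trivialObj (E : Set (OmegaIdentity S)) : OmegaVariety.{w, u} E where
  carrier := PUnit
  addGroup := inferInstance
  omegaGroup := { op := fun _ _ => 0, op_zero := fun _ => rfl }
  satisfies _ _ _ := rfl

instance (E : Set (OmegaIdentity S)) : Subsingleton (trivialObj.{w, u} E) :=
  inferInstanceAs (Subsingleton PUnit)

theorem trivialObj_mem_subvariety : subvariety.{w, u} E Φ (trivialObj E) :=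
  fun _ _ _ => Subsingleton.elim _ _

/-- The zero morphism. -/
def zeroHom (A B : OmegaVariety.{w, u} E) : A ⟶ B where
  toAddMonoidHom := 0
  map_op' ω _ := (OmegaGroup.op_zero ω).symm

/-- The inclusion of an ideal, as a morphism of the variety. -/
def ofIdealIncl (A : OmegaVariety.{w, u} E) (I : OmegaIdeal S A) : A.ofIdeal I ⟶ A :=
  I.incl

section Pullback

variable {A B Z : OmegaVariety.{w, u} E} (f : A ⟶ Z) (g : B ⟶ Z)

/-- The underlying subgroup of the fibre product. -/
def pullbackSubgroup : AddSubgroup (A × B) :=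
  (f.toAddMonoidHom.comp (AddMonoidHom.fst A B)).eqLocus
    (g.toAddMonoidHom.comp (AddMonoidHom.snd A B))

theorem mem_pullbackSubgroup {x : A × B} :
    x ∈ pullbackSubgroup f g ↔ f.toAddMonoidHom x.1 = g.toAddMonoidHom x.2 := Iff.rfl

instance : OmegaGroup S (pullbackSubgroup f g) where
  op ω x := ⟨(OmegaGroup.op ω fun i => (x i).1.1, OmegaGroup.op ω fun i => (x i).1.2), by
    rw [mem_pullbackSubgroup, OmegaHom.map_op, OmegaHom.map_op]
    exact congrArg _ (funext fun i => (x i).2)⟩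
  op_zero ω := Subtype.ext (Prod.ext (OmegaGroup.op_zero (A := A) ω)
    (OmegaGroup.op_zero (A := B) ω))

/-- The first projection of the fibre product. -/
def pullbackFst : OmegaHom S (pullbackSubgroup f g) A where
  toAddMonoidHom := (AddMonoidHom.fst A B).comp (pullbackSubgroup f g).subtype
  map_op' _ _ := rfl

/-- The second projection of the fibre product. -/
def pullbackSnd : OmegaHom S (pullbackSubgroup f g) B where
  toAddMonoidHom := (AddMonoidHom.snd A B).comp (pullbackSubgroup f g).subtype
  map_op' _ _ := rfl

/-- The fibre product. -/
def pullbackObj : OmegaVariety.{w, u} E where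
  carrier := pullbackSubgroup f g
  satisfies e he v := by
    refine Subtype.ext (Prod.ext ?_ ?_)
    · have h := A.satisfies e he fun n => (v n).1.1
      exact ((pullbackFst f g).map_eval v e.1).trans
        (h.trans ((pullbackFst f g).map_eval v e.2).symm)
    · have h := B.satisfies e he fun n => (v n).1.2
      exact ((pullbackSnd f g).map_eval v e.1).trans
        (h.trans ((pullbackSnd f g).map_eval v e.2).symm)

/-- The morphism into the fibre product induced by a commutative square. -/
def pullbackLift {T : OmegaVariety.{w, u} E} (p : T ⟶ A) (q : T ⟶ B) (h : p ≫ f = q ≫ g) :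
    T ⟶ pullbackObj f g where
  toAddMonoidHom := (p.toAddMonoidHom.prod q.toAddMonoidHom).codRestrict (pullbackSubgroup f g)
    fun t => congr_hom h t
  map_op' ω t := Subtype.ext (Prod.ext (OmegaHom.map_op p ω t) (OmegaHom.map_op q ω t))

theorem isPullback_pullbackObj :
    IsPullback (P := pullbackObj f g) (pullbackFst f g) (pullbackSnd f g) f g where
  w := hom_ext fun x => x.2
  isLimit' := ⟨PullbackCone.IsLimit.mk _ (fun s => pullbackLift f g s.fst s.snd s.condition)
    (fun _ => rfl) (fun _ => rfl) fun _ _ h₁ h₂ => hom_ext fun t =>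
      Subtype.ext (Prod.ext (congr_hom h₁ t) (congr_hom h₂ t))⟩

instance : HasPullbacks (OmegaVariety.{w, u} E) :=
  have (A B Z : OmegaVariety.{w, u} E) (f : A ⟶ Z) (g : B ⟶ Z) : HasLimit (cospan f g) :=
    (isPullback_pullbackObj f g).hasPullback
  hasPullbacks_of_hasLimit_cospan _

end Pullback

/-! ### The unit of the reflection, and the return to attainability -/

section Reflection

variable {F : OmegaVariety.{w, u} E ⥤ (subvariety.{w, u} E Φ).FullSubcategory}

theorem exists_unit_comp_eq (adj : F ⊣ (subvariety.{w, u} E Φ).ι)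
    {A : OmegaVariety.{w, u} E} {Z : OmegaVariety.{w, u} E}
    (hZ : SatisfiesIdentities Φ Z) (f : A ⟶ Z) :
    ∃ g : (F.obj A).obj ⟶ Z, adj.unit.app A ≫ g = f := by
  let Z' : (subvariety.{w, u} E Φ).FullSubcategory := ⟨Z, hZ⟩
  refine ⟨((adj.homEquiv A Z').symm f).hom, ?_⟩
  exact (adj.homEquiv_unit (f := (adj.homEquiv A Z').symm f)).symm.trans
    ((adj.homEquiv A Z').apply_symm_apply f)

theorem unit_apply_eq_zero_iff (adj : F ⊣ (subvariety.{w, u} E Φ).ι)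
    {A : OmegaVariety.{w, u} E} {a : A} :
    OmegaHom.toAddMonoidHom (adj.unit.app A) a = 0 ↔ a ∈ (verbal Φ A).toAddSubgroup := by
  refine ⟨fun h => ?_, fun h => map_eq_zero_of_mem_verbal _ (F.obj A).property h⟩
  obtain ⟨g, hg⟩ := exists_unit_comp_eq adj (Z := A.quotient (verbal Φ A))
    (satisfies_quotient_verbal Φ A) (verbal Φ A).proj
  rw [← proj_eq_zero_iff]
  refine (congr_hom hg a).symm.trans ?_
  rw [comp_apply, h]
  exact map_zero _

/-- `F` is an arbitrary left adjoint, so its unit must be compared with the projection to `A /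
A(Φ)`: the universal property makes the comparison map `c` a split epimorphism. -/
theorem unit_surjective (adj : F ⊣ (subvariety.{w, u} E Φ).ι)
    (A : OmegaVariety.{w, u} E) :
    Function.Surjective (OmegaHom.toAddMonoidHom (adj.unit.app A)) := by
  let V := verbal Φ A
  obtain ⟨g, hg⟩ := exists_unit_comp_eq adj (Z := A.quotient V)
    (satisfies_quotient_verbal Φ A) V.proj
  let c : A.quotient V ⟶ (F.obj A).obj :=
    OmegaHom.quotientLift V (adj.unit.app A) (verbal_le_ker _ (F.obj A).property)
  have hc : adj.unit.app A ≫ g ≫ c = adj.unit.app A := by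
    rw [← Category.assoc, hg]
    exact hom_ext fun _ => rfl
  have hgc : ObjectProperty.homMk (g ≫ c) = 𝟙 (F.obj A) := by
    apply (adj.homEquiv _ _).injective
    rw [adj.homEquiv_unit, adj.homEquiv_unit]
    simpa using hc
  intro b
  obtain ⟨a, ha⟩ := V.proj_surjective (g.toAddMonoidHom b)
  refine ⟨a, ?_⟩
  have h := congr_hom (congrArg InducedCategory.Hom.hom hgc) b
  refine Eq.trans ?_ h
  change c.toAddMonoidHom (V.proj.toAddMonoidHom a) = c.toAddMonoidHom (g.toAddMonoidHom b)
  rw [ha]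

theorem isIso_homEquiv_symm (adj : F ⊣ (subvariety.{w, u} E Φ).ι)
    {P : OmegaVariety.{w, u} E}
    {X : (subvariety.{w, u} E Φ).FullSubcategory} (q : P ⟶ (subvariety.{w, u} E Φ).ι.obj X)
    (hq : Function.Surjective q.toAddMonoidHom)
    (hker : ∀ x, q.toAddMonoidHom x = 0 → x ∈ (verbal Φ P).toAddSubgroup) :
    IsIso ((adj.homEquiv P X).symm q) := by
  set t := (adj.homEquiv P X).symm q
  have ht : adj.unit.app P ≫ t.hom = q :=
    (adj.homEquiv_unit (f := t)).symm.trans ((adj.homEquiv P X).apply_symm_apply q)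
  rw [← ObjectProperty.isIso_hom_iff]
  have hbij : Function.Bijective t.hom.toAddMonoidHom := by
    constructor
    · rw [injective_iff_map_eq_zero]
      intro y hy
      obtain ⟨x, rfl⟩ := unit_surjective adj P y
      exact (unit_apply_eq_zero_iff adj).2 (hker x ((congr_hom ht x).symm.trans hy))
    · intro y
      obtain ⟨x, rfl⟩ := hq y
      exact ⟨_, congr_hom ht x⟩
  let eqv := AddEquiv.ofBijective _ hbij
  let inv : X.obj ⟶ (F.obj P).obj :=
    { toAddMonoidHom := eqv.symm.toAddMonoidHom
      map_op' := fun ω x => by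
        apply hbij.1
        refine (eqv.apply_symm_apply _).trans ?_
        rw [OmegaHom.map_op]
        exact congrArg _ (funext fun j => (eqv.apply_symm_apply (x j)).symm) }
  exact ⟨inv, hom_ext eqv.symm_apply_apply, hom_ext eqv.apply_symm_apply⟩

theorem isAdmissibleReflection (adj : F ⊣ (subvariety.{w, u} E Φ).ι)
    (h : ∀ A : OmegaVariety.{w, u} E, IsAttainableOn Φ A) :
    IsAdmissibleReflection adj := by
  intro A X g P p q hP
  have hQ := isPullback_pullbackObj (adj.unit.app A) ((subvariety.{w, u} E Φ).ι.map g)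
  let Q := pullbackObj (adj.unit.app A) ((subvariety.{w, u} E Φ).ι.map g)
  let q' : Q ⟶ (subvariety.{w, u} E Φ).ι.obj X := pullbackSnd _ _
  have hq : q = (hP.isoIsPullback _ _ hQ).hom ≫ q' := (hP.isoIsPullback_hom_snd _ _ hQ).symm
  rw [hq, adj.homEquiv_naturality_left_symm]
  suffices IsIso ((adj.homEquiv Q X).symm q') by infer_instance
  refine isIso_homEquiv_symm adj q' (fun x => ?_) fun x hx => ?_
  · obtain ⟨a, ha⟩ := unit_surjective adj A (g.hom.toAddMonoidHom x)
    exact ⟨⟨(a, x), ha⟩, rfl⟩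
  · let V := verbal Φ A
    -- The map `a ↦ (a, 0)` identifies `A(Φ)` with the kernel of `q'`.
    let j : A.ofIdeal V ⟶ Q := pullbackLift _ _ (A.ofIdealIncl V) (zeroHom _ _) (hom_ext fun a =>
      ((unit_apply_eq_zero_iff adj).2 a.2).trans (map_zero g.hom.toAddMonoidHom).symm)
    have hxV : x.1.1 ∈ V.toAddSubgroup := by
      rw [← unit_apply_eq_zero_iff adj]
      exact x.2.trans ((congrArg _ hx).trans (map_zero g.hom.toAddMonoidHom))
    have hjx : j.toAddMonoidHom ⟨x.1.1, hxV⟩ = x := Subtype.ext (Prod.ext rfl hx.symm)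
    rw [← proj_eq_zero_iff, ← hjx]
    exact map_eq_zero_of_mem_verbal (OmegaHom.comp (verbal Φ Q).proj j)
      (satisfies_quotient_verbal Φ Q) ((AddSubgroup.eq_top_iff' _).1 (h A) _)

/-- If the inclusion of the verbal ideal of `A` factors through a morphism from an object with
trivial reflection, then `Φ` is attainable on `A`. -/
theorem isAttainableOn_of_factorization
    (adj : F ⊣ (subvariety.{w, u} E Φ).ι) {A B : OmegaVariety.{w, u} E} (φ : B ⟶ A)
    (hB : Subsingleton (F.obj B).obj) (χ : A.ofIdeal (verbal Φ A) ⟶ B)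
    (hχ : χ ≫ φ = A.ofIdealIncl (verbal Φ A)) : IsAttainableOn Φ A := by
  have hB' (b : B) : b ∈ (verbal Φ B).toAddSubgroup :=
    (unit_apply_eq_zero_iff adj).1 (Subsingleton.elim (α := (F.obj B).obj) _ _)
  have hφ (b : B) : φ.toAddMonoidHom b ∈ (verbal Φ A).toAddSubgroup := by
    rw [← proj_eq_zero_iff]
    exact map_eq_zero_of_mem_verbal ((verbal Φ A).proj.comp φ) (satisfies_quotient_verbal Φ A)
      (hB' b)
  -- Since `B(Φ) = B`, `φ` lands in `A(Φ)`, and `ψ` is then a retraction of `χ`. So `A(Φ)` is a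
  -- quotient of `B` and inherits `B(Φ) = B`.
  let ψ : B ⟶ A.ofIdeal (verbal Φ A) := OmegaHom.codRestrict φ (verbal Φ A) hφ
  refine verbal_eq_top_of_forall_map_eq_zero fun a => ?_
  have ha : ψ.toAddMonoidHom (χ.toAddMonoidHom a) = a := Subtype.ext (congr_hom hχ a)
  have h := map_eq_zero_of_mem_verbal ((verbal Φ _).proj.comp ψ)
    (satisfies_quotient_verbal Φ (verbal Φ A).toAddSubgroup) (hB' (χ.toAddMonoidHom a))
  rw [← ha]
  exact h

/-- The trivial object of the subvariety. -/
def trivialSub (E Φ : Set (OmegaIdentity S)) : (subvariety.{w, u} E Φ).FullSubcategory :=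
  ⟨trivialObj E, trivialObj_mem_subvariety⟩

theorem subsingleton_of_iso {X : (subvariety.{w, u} E Φ).FullSubcategory}
    (e : X ≅ trivialSub E Φ) : Subsingleton X.obj where
  allEq x y := by
    have h (x : X.obj) :
        e.inv.hom.toAddMonoidHom (e.hom.hom.toAddMonoidHom x) = x :=
      congr_hom (congrArg InducedCategory.Hom.hom e.hom_inv_id) x
    rw [← h x, ← h y]
    exact congrArg _ (Subsingleton.elim (α := trivialObj E) _ _)

/-- The reflection of the inclusion of the verbal ideal is the zero morphism. -/
theorem map_incl_verbal
    (adj : F ⊣ (subvariety.{w, u} E Φ).ι) (A : OmegaVariety.{w, u} E) :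
    F.map (A.ofIdealIncl (verbal Φ A)) =
      ObjectProperty.homMk (zeroHom _ _) := by
  apply (adj.homEquiv _ _).injective
  rw [adj.homEquiv_unit, adj.homEquiv_unit]
  refine (adj.unit_naturality _).trans ?_
  refine hom_ext fun a => ?_
  exact (unit_apply_eq_zero_iff adj).2 a.2

theorem isAttainableOn_of_isAdmissibleObject
    (adj : F ⊣ (subvariety.{w, u} E Φ).ι) {A : OmegaVariety.{w, u} E}
    (h : IsAdmissibleObject F A) : IsAttainableOn Φ A := by
  obtain ⟨G, ⟨a⟩, _, _⟩ := h
  let Y : Over (F.obj A) := Over.mk (Y := trivialSub E Φ) (ObjectProperty.homMk (zeroHom _ _))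
  let K : Over A := Over.mk (A.ofIdealIncl (verbal Φ A))
  let z : (Over.post F).obj K ⟶ Y := Over.homMk (ObjectProperty.homMk (zeroHom _ _)) (by
    refine Eq.trans ?_ (map_incl_verbal adj A).symm
    ext : 1
    exact hom_ext fun _ => rfl)
  let χ := a.homEquiv _ _ z
  -- The counit is invertible because `G` is fully faithful; thus the domain of `G Y` has trivial
  -- reflection.
  have : IsIso (a.counit.app Y) := inferInstance
  refine isAttainableOn_of_factorization adj (G.obj Y).hom
    (subsingleton_of_iso ((Over.forget _).mapIso (asIso (a.counit.app Y)))) χ.left (Over.w χ)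

theorem isAttainableOn_of_isSemiLeftExact
    (adj : F ⊣ (subvariety.{w, u} E Φ).ι)
    (h : IsSemiLeftExact F (subvariety.{w, u} E Φ).ι) (A : OmegaVariety.{w, u} E) :
    IsAttainableOn Φ A := by
  let f : A ⟶ (subvariety.{w, u} E Φ).ι.obj (F.obj A) := adj.unit.app A
  let g : trivialSub.{w, u} E Φ ⟶ F.obj A := ObjectProperty.homMk (zeroHom _ _)
  have := h f g
  have hP := isPullback_pullbackObj f ((subvariety.{w, u} E Φ).ι.map g)
  have hFP := hP.map F
  -- `F` inverts the unit, so it also inverts the projection of the preserved pullback onto the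
  -- trivial object.
  have : IsIso (F.map f) :=
    have : IsIso (F.map f ≫ adj.counit.app (F.obj A)) := by
      rw [adj.left_triangle_components A]
      infer_instance
    IsIso.of_isIso_comp_right _ (adj.counit.app (F.obj A))
  have hiso := hFP.isIso_snd_of_isIso
  let χ : A.ofIdeal (verbal Φ A) ⟶ pullbackObj f ((subvariety.{w, u} E Φ).ι.map g) :=
    pullbackLift _ _ (A.ofIdealIncl (verbal Φ A)) (zeroHom _ _) (hom_ext fun a =>
      ((unit_apply_eq_zero_iff adj).2 a.2).trans (map_zero g.hom.toAddMonoidHom).symm)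
  exact isAttainableOn_of_factorization adj (pullbackFst _ _)
    (subsingleton_of_iso (@asIso _ _ _ _ _ hiso ≪≫ asIso (adj.counit.app _))) χ rfl

theorem isAttainableOn_of_isEssentiallyFibration
    (adj : F ⊣ (subvariety.{w, u} E Φ).ι) (h : IsEssentiallyFibration F)
    (A : OmegaVariety.{w, u} E) : IsAttainableOn Φ A := by
  obtain ⟨B, φ, e, he, hφ⟩ := h (A := A) (Y := trivialSub E Φ) (ObjectProperty.homMk (zeroHom _ _))
  let ψ := A.ofIdealIncl (verbal Φ A)
  let k : F.obj (A.ofIdeal (verbal Φ A)) ⟶ F.obj B := ObjectProperty.homMk (zeroHom _ _)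
  have hk : k ≫ F.map φ = F.map ψ := by
    refine Eq.trans ?_ (map_incl_verbal adj A).symm
    ext : 1
    exact hom_ext fun _ => map_zero (F.map φ).hom.toAddMonoidHom
  have : F.IsHomLift (k ≫ F.map φ) ψ := by rw [hk]; infer_instance
  obtain ⟨χ, ⟨-, hχ⟩, -⟩ := hφ.universal_property' k ψ
  exact isAttainableOn_of_factorization adj φ (subsingleton_of_iso e) χ hχ

end Reflection

end OmegaVariety

theorem theorem4p5 (S : OmegaSignature.{w}) (E Φ : Set (OmegaIdentity S)) :
    (OmegaVariety.subvariety.{w, u} E Φ).ι.IsRightAdjoint ∧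
    ∀ (F : OmegaVariety.{w, u} E ⥤ (OmegaVariety.subvariety.{w, u} E Φ).FullSubcategory)
      (_adj : F ⊣ (OmegaVariety.subvariety.{w, u} E Φ).ι),
      List.TFAE [
        OmegaVariety.IsSemisimpleClass (OmegaVariety.subvariety.{w, u} E Φ),
        ∀ A : OmegaVariety.{w, u} E, OmegaVariety.IsAttainableOn Φ A,
        ∀ A : OmegaVariety.{w, u} E, IsAdmissibleObject F A,
        IsSemiLeftExact F (OmegaVariety.subvariety.{w, u} E Φ).ι,
        IsEssentiallyFibration F] := by
  refine ⟨OmegaVariety.isRightAdjoint_ι E Φ, fun F adj => ?_⟩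
  tfae_have 1 → 2 := OmegaVariety.isAttainableOn_of_isSemisimpleClass
  tfae_have 2 → 1 := OmegaVariety.isSemisimpleClass_of_isAttainableOn
  tfae_have 2 → 3 := fun h => (OmegaVariety.isAdmissibleReflection adj h).isAdmissibleObject
  tfae_have 2 → 4 := fun h => (OmegaVariety.isAdmissibleReflection adj h).isSemiLeftExact
  tfae_have 2 → 5 := fun h => (OmegaVariety.isAdmissibleReflection adj h).isEssentiallyFibration
  tfae_have 3 → 2 := fun h A => OmegaVariety.isAttainableOn_of_isAdmissibleObject adj (h A)
  tfae_have 4 → 2 := OmegaVariety.isAttainableOn_of_isSemiLeftExact adj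
  tfae_have 5 → 2 := OmegaVariety.isAttainableOn_of_isEssentiallyFibration adj
  tfae_finish
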